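/- **Setting.** An instance consists of agents $N=\{1,\dots,n\}$, a normalised monotone submodular valuation $v:2^N\to\mathbb{R}_{\ge 0}$ ($v(\emptyset)=0$), a budget $B>0$ and costs $0<c_i\le B$. Write $v(i)=v(\{i\})$ and $v(i\mid S)=v(S\cup\{i\})-v(S)$, and let $S^*$ be an optimal solution of $$\max v(S)\quad\text{s.t.}\quad \textstyle\sum_{i\in S}c_i\le B,\ S\subseteq N. \tag{1}$$ The agents arrive in a uniformly random order. All random choices below are independent of each other and of the arrival order. *Posted-price procedure with threshold $t$* on a sequence of agents: start with $S=\emptyset$ and $B'=B$. When agent $i$ arrives, offer the price $\bar p_i=\frac{B}{t}\,v(i\mid S)$. If $c_i\le\bar p_i$ and $B'-\bar p_i\ge 0$, add $i$ to $S$, pay her $\bar p_i$ and replace $B'$ by $B'-\bar p_i$. (If $t=0$, nobody is hired.) *Mechanism 2* (uses a prediction $\omega$; parameters $p,a,z$): with probability $p$, hire the first arriving agent $j$ with $v(j)\ge a\omega/z$ (if any) and pay her $B$. With probability $1-p$, run the posted-price procedure with $t=a\omega$ on all agents in arrival order. *Mechanism 3* (no prediction; parameters $q,\beta$): with probability $q$,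 run Dynkin's algorithm: sample the first $\lfloor n/e\rfloor$ agents, let $i^*$ be the most valuable of them, and hire the first later agent $j$ (if any) with $v(j)\ge v(i^*)$, paying her $B$; here ties between the values of single agents are broken by an arbitrary order on $N$ fixed in advance, and if the sample is empty the first agent is hired. With probability $1-q$, draw $\xi_1$ from the binomial distribution $\mathcal B(n,\tfrac12)$, let $N_1$ be the set of the first $\xi_1$ agents, let $T_1\subseteq N_1$ be a $(1-\frac1e)$-approximate solution of (1) restricted to $N_1$ (for instance the one found by Sviridenko's algorithm), and run the posted-price procedure with $t=\beta\, v(T_1)$ on the agents of $N\setminus N_1$ in arrival order. *Mechanism 1* (tolerance $\tau\in[0,1)$): with probability $\tau$ run Mechanism 2, and with probability $1-\tau$ run Mechanism 3. **Statement.** Let $\tau\in[0,1)$ and $\varepsilon\in(0,1)$. Run Mechanism 1 with tolerance $\tau$ and the prediction $\omega=(1-\varepsilon)\,v(S^*)$, where $p=0.46$, $a=0.685$, $z=1.85$ in Mechanism 2 and $q=0.66$, $\beta=0.29$ in Mechanism 3. Then, for every instance and every choice of the tie-breaking order and of the $(1-\frac1e)$-approximate solutions $T_1$ (as a function of $N_1$),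 the set $A$ of hired agents satisfies $$\left(\tau\cdot\frac{1-\varepsilon}{6}+(1-\tau)\cdot\frac1{146}\right)^{-1}\cdot\mathbb E[v(A)]\ \ge\ v(S^*),$$ where the expectation is over the random arrival order and the random choices of the mechanism. -/

import Mathlib

namespace OnlineProcurement

/-- An instance with agent set `N = Fin n`: a normalised monotone submodular valuation `v`,
a budget `B > 0` and costs `0 < c i ≤ B`. -/
structure ProcInstance (n : ℕ) where
  v : Finset (Fin n) → ℝ
  c : Fin n → ℝ
  B : ℝ
  v_empty : v ∅ = 0
  v_mono : ∀ S T : Finset (Fin n), S ⊆ T → v S ≤ v T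
  v_submod : ∀ (S T : Finset (Fin n)) (i : Fin n), S ⊆ T → i ∉ T →
    v (insert i T) - v T ≤ v (insert i S) - v S
  B_pos : 0 < B
  c_pos : ∀ i, 0 < c i
  c_le : ∀ i, c i ≤ B

/-- The marginal value `v(i | S)`. -/
def ProcInstance.marginal {n : ℕ} (I : ProcInstance n) (i : Fin n) (S : Finset (Fin n)) : ℝ :=
  I.v (insert i S) - I.v S

/-- The total cost of `S` is within the budget. -/
def ProcInstance.Feasible {n : ℕ} (I : ProcInstance n) (S : Finset (Fin n)) : Prop :=
  ∑ i ∈ S, I.c i ≤ I.B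

/-- `S` is an optimal solution of `max v(S)` subject to `∑ i ∈ S, c i ≤ B`, `S ⊆ N`. -/
def ProcInstance.IsOptimal {n : ℕ} (I : ProcInstance n) (S : Finset (Fin n)) : Prop :=
  I.Feasible S ∧ ∀ T : Finset (Fin n), I.Feasible T → I.v T ≤ I.v S

/-- `T` is a `ρ`-approximate solution of the same packing problem restricted to the
agents in `N₁`. -/
def ProcInstance.IsApproxSolution {n : ℕ} (I : ProcInstance n) (ρ : ℝ)
    (N₁ T : Finset (Fin n)) : Prop :=
  T ⊆ N₁ ∧ I.Feasible T ∧ ∀ T' : Finset (Fin n), T' ⊆ N₁ → I.Feasible T' → ρ * I.v T' ≤ I.v T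

/-- The outcome of a mechanism: the set of hired agents and the payments. -/
structure Outcome (n : ℕ) where
  winners : Finset (Fin n)
  payment : Fin n → ℝ

/-- Nobody is hired and nobody is paid. -/
def Outcome.none (n : ℕ) : Outcome n := ⟨∅, 0⟩

/-- Hire only agent `j` (if there is one) and pay her the amount `P`. -/
def hireSingle {n : ℕ} (P : ℝ) : Option (Fin n) → Outcome n
  | Option.none => Outcome.none n
  | some j => ⟨{j}, Pi.single j P⟩

/-- The state of the posted-price procedure: the current outcome and the remaining budget. -/
structure PostedState (n : ℕ) where
  out : Outcome n
  budgetLeft : ℝ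

open Classical in
/-- Agent `i` arrives and is offered the price `(B / t) * v(i | S)`; she is hired at that price
when her cost does not exceed it and the remaining budget suffices.
(For `t = 0` the price is `0` by the convention `B / 0 = 0`, and nobody is hired, since costs
are positive.) -/
noncomputable def postedStep {n : ℕ} (I : ProcInstance n) (t : ℝ) (s : PostedState n)
    (i : Fin n) : PostedState n :=
  let price := I.B / t * I.marginal i s.out.winners
  if I.c i ≤ price ∧ 0 ≤ s.budgetLeft - price then
    ⟨⟨insert i s.out.winners, Function.update s.out.payment i price⟩, s.budgetLeft - price⟩
  else s

/-- The posted-price procedure with threshold `t` on the agents of `arrivals`, in that order. -/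
noncomputable def postedPrice {n : ℕ} (I : ProcInstance n) (t : ℝ) (arrivals : List (Fin n)) :
    Outcome n :=
  (arrivals.foldl (postedStep I t) ⟨Outcome.none n, I.B⟩).out

open Classical in
/-- Hire the first agent `j` with `θ ≤ v(j)` and pay her `B`. -/
noncomputable def firstAbove {n : ℕ} (I : ProcInstance n) (θ : ℝ) (arrivals : List (Fin n)) :
    Outcome n :=
  hireSingle I.B (arrivals.find? fun j => decide (θ ≤ I.v {j}))

/-- `j` is more valuable than `i`, where ties `v(i) = v(j)` are broken by the fixed order `tie`
of the agents. (If distinct agents have distinct values, then for `i ≠ j` this is just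
`v(i) ≤ v(j)`.) -/
def ProcInstance.Beats {n : ℕ} (I : ProcInstance n) (tie : Equiv.Perm (Fin n))
    (j i : Fin n) : Prop :=
  I.v {i} < I.v {j} ∨ (I.v {i} = I.v {j} ∧ tie i < tie j)

open Classical in
/-- Dynkin's algorithm: sample the first `⌊n / e⌋` agents; among the remaining agents hire the
first one who beats the most valuable sampled agent (equivalently, all sampled agents), and pay
her `B`. -/
noncomputable def dynkin {n : ℕ} (I : ProcInstance n) (tie : Equiv.Perm (Fin n))
    (arrivals : List (Fin n)) : Outcome n :=
  let r := ⌊(n : ℝ) / Real.exp 1⌋₊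
  hireSingle I.B
    ((arrivals.drop r).find? fun j => decide (∀ i ∈ arrivals.take r, I.Beats tie j i))

/-- A coin that shows `true` with probability `r`. -/
noncomputable def coin (r : unitInterval) : PMF Bool :=
  PMF.bernoulli (unitInterval.toNNReal r) (by exact_mod_cast r.2.2)

/-- The mechanism using the prediction `ω`, on a fixed arrival sequence. -/
noncomputable def predMechanism {n : ℕ} (I : ProcInstance n) (ω : ℝ) (p : unitInterval)
    (a z : ℝ) (arrivals : List (Fin n)) : PMF (Outcome n) :=
  (coin p).map fun b =>
    if b then firstAbove I (a * ω / z) arrivals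
    else postedPrice I (a * ω) arrivals

/-- The mechanism without prediction, on a fixed arrival sequence: Dynkin's algorithm with
probability `q`; otherwise `ξ` is drawn from the binomial distribution with parameters `n` and
`1/2`, `N₁` is the set of the first `ξ` agents, and the posted-price procedure with
`t = β * v(T₁ N₁)` is run on the agents arriving after them. -/
noncomputable def noPredMechanism {n : ℕ} (I : ProcInstance n) (tie : Equiv.Perm (Fin n))
    (T₁ : Finset (Fin n) → Finset (Fin n)) (q : unitInterval) (β : ℝ)
    (arrivals : List (Fin n)) : PMF (Outcome n) :=
  (coin q).bind fun b =>
    if b then PMF.pure (dynkin I tie arrivals)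
    else (PMF.binomial (1 / 2) (by norm_num) n).map fun ξ =>
      postedPrice I (β * I.v (T₁ (arrivals.take ξ).toFinset)) (arrivals.drop ξ)

/-- The combined mechanism, on a fixed arrival sequence: with probability `τ` the mechanism using
the prediction, with probability `1 - τ` the one without prediction. -/
noncomputable def combinedMechanism {n : ℕ} (I : ProcInstance n) (ω : ℝ) (τ : unitInterval)
    (p : unitInterval) (a z : ℝ)
    (tie : Equiv.Perm (Fin n)) (T₁ : Finset (Fin n) → Finset (Fin n)) (q : unitInterval) (β : ℝ)
    (arrivals : List (Fin n)) : PMF (Outcome n) :=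
  (coin τ).bind fun b =>
    if b then predMechanism I ω p a z arrivals
    else noPredMechanism I tie T₁ q β arrivals

/-- The random order model: the mechanism `M` is run on the arrival sequence
`π(1), …, π(n)` of a uniformly random permutation `π`. -/
noncomputable def randomOrder {n : ℕ} (M : List (Fin n) → PMF (Outcome n)) : PMF (Outcome n) :=
  (PMF.uniformOfFintype (Equiv.Perm (Fin n))).bind fun π => M (List.ofFn π)

/-- The expected value of the set of hired agents. -/
noncomputable def expectedValue {n : ℕ} (I : ProcInstance n) (P : PMF (Outcome n)) : ℝ :=
  ∑ S : Finset (Fin n), ((P.map Outcome.winners) S).toReal * I.v S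

end OnlineProcurement

namespace OnlineProcurement

set_option linter.deprecated false

/-! ### Monotone submodular valuations -/

namespace ProcInstance

variable {n : ℕ} (I : ProcInstance n)

/-! Write V = v(S*) and let M be the largest value of a single agent. By linearity of expectation it
suffices that the mechanism with prediction earns (1-ε)V/6 and the one without earns V/146. Each
mixes a single-agent rule, good when some agent is valuable, with posted prices, good when all
agents are small.

Posted prices spend exactly B/t per unit of value. So if a price ever exceeds the remaining budget,
value t - M is already hired. Otherwise every rejected agent i has marginal value at most t c_i / B,
at the end too by submodularity, so a feasible T among the arriving agents can add at most t and the
outcome is worth at least v(T) - t (`postedPrice_value`). With t = aω this settles the prediction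
case for every arrival order.

Without prediction the sample R is a uniformly random subset (`sum_perm_binomial`). An additive w
below v on the subsets of S*, with total V (`exists_additive_minorant`), has variance at most MV/4
on S* ∩ R. By Chebyshev, for small M/V, both S* ∩ R and S* \ R are likely to carry about half of V:
the first makes the threshold large, the second leaves enough to hire. For larger M, Dynkin's
expected 0.18 M (`dynkin_value`) takes over. -/

theorem v_nonneg (S : Finset (Fin n)) : 0 ≤ I.v S :=
  I.v_empty ▸ I.v_mono ∅ S (Finset.empty_subset S)

theorem v_insert (i : Fin n) (S : Finset (Fin n)) :
    I.v (insert i S) = I.v S + I.marginal i S := by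
  simp [marginal]

theorem marginal_anti {S T : Finset (Fin n)} (h : S ⊆ T) {i : Fin n} (hi : i ∉ T) :
    I.marginal i T ≤ I.marginal i S :=
  I.v_submod S T i h hi

theorem marginal_nonneg (i : Fin n) (S : Finset (Fin n)) : 0 ≤ I.marginal i S :=
  sub_nonneg.2 (I.v_mono _ _ (Finset.subset_insert i S))

theorem marginal_le_singleton (i : Fin n) (S : Finset (Fin n)) :
    I.marginal i S ≤ I.v {i} := by
  by_cases hi : i ∈ S
  · simpa [marginal, Finset.insert_eq_of_mem hi] using I.v_nonneg {i}
  · simpa [marginal, I.v_empty] using I.marginal_anti (Finset.empty_subset S) hi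

theorem v_union_le (S T : Finset (Fin n)) :
    I.v (S ∪ T) ≤ I.v S + ∑ i ∈ T, I.marginal i S := by
  induction T using Finset.induction_on with
  | empty => simp
  | insert a T ha ih =>
    rw [Finset.sum_insert ha, Finset.union_insert]
    by_cases h : a ∈ S ∪ T
    · rw [Finset.insert_eq_of_mem h]
      linarith [I.marginal_nonneg a S]
    · rw [v_insert]
      linarith [I.marginal_anti (Finset.subset_union_left (s₁ := S) (s₂ := T)) h]

/-- A monotone submodular valuation dominates, on the subsets of `S`, an additive one
with the same value at `S`. -/
theorem exists_additive_minorant (S : Finset (Fin n)) :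
    ∃ w : Fin n → ℝ, (∀ i, 0 ≤ w i) ∧ (∀ i, w i ≤ I.v {i}) ∧ ∑ i ∈ S, w i = I.v S ∧
      ∀ R ⊆ S, ∑ i ∈ R, w i ≤ I.v R := by
  induction S using Finset.induction_on with
  | empty =>
    refine ⟨0, fun _ => le_rfl, fun i => I.v_nonneg _, by simp [I.v_empty], fun R hR => ?_⟩
    simpa using I.v_nonneg R
  | insert a S ha ih =>
    obtain ⟨w, h0, h1, h2, h3⟩ := ih
    have hsum : ∀ R, a ∉ R →
        ∑ i ∈ R, Function.update w a (I.marginal a S) i = ∑ i ∈ R, w i := fun R hR =>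
      Finset.sum_congr rfl fun i hi =>
        Function.update_of_ne (ne_of_mem_of_not_mem hi hR) _ _
    -- Greedy weights: each agent gets her marginal value over those inserted before her. The total
    -- telescopes, and over a smaller set her marginal value is at least this weight.
    refine ⟨Function.update w a (I.marginal a S), fun i => ?_, fun i => ?_, ?_, fun R hR => ?_⟩
    · by_cases h : i = a
      · subst h; simpa using I.marginal_nonneg i S
      · simpa [h] using h0 i
    · by_cases h : i = a
      · subst h; simpa using I.marginal_le_singleton i S
      · simpa [h] using h1 i
    · rw [Finset.sum_insert ha, hsum S ha, h2, v_insert, Function.update_self, add_comm]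
    · by_cases h : a ∈ R
      · have hR' : R.erase a ⊆ S := fun i hi =>
          Finset.mem_of_mem_insert_of_ne (hR (Finset.mem_of_mem_erase hi)) (Finset.ne_of_mem_erase hi)
        rw [← Finset.insert_erase h, Finset.sum_insert (Finset.notMem_erase a R),
          hsum _ (Finset.notMem_erase a R), v_insert, Function.update_self]
        linarith [h3 _ hR', I.marginal_anti hR' ha]
      · rw [hsum R h]
        exact h3 R ((Finset.subset_insert_iff_of_notMem h).1 hR)

theorem feasible_mono {S T : Finset (Fin n)} (h : S ⊆ T) (hT : I.Feasible T) : I.Feasible S :=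
  (Finset.sum_le_sum_of_subset_of_nonneg h fun i _ _ => (I.c_pos i).le).trans hT

end ProcInstance

/-! ### The posted-price procedure -/

/-- The posted-price procedure stops short of a threshold only for lack of budget, or every
rejected agent was too expensive. -/
theorem postedStep_foldl_spec {n : ℕ} (I : ProcInstance n) {t M : ℝ} (ht : 0 < t)
    (hM : ∀ i, I.v {i} ≤ M) (l : List (Fin n)) (s : PostedState n)
    (hs : I.B * I.v s.out.winners = t * (I.B - s.budgetLeft)) :
    s.out.winners ⊆ (l.foldl (postedStep I t) s).out.winners ∧
      (t - M ≤ I.v (l.foldl (postedStep I t) s).out.winners ∨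
        ∀ i ∈ l, i ∉ (l.foldl (postedStep I t) s).out.winners →
          I.B * I.marginal i (l.foldl (postedStep I t) s).out.winners ≤ t * I.c i) := by
  -- The invariant `hs` says that the money spent is B/t times the value hired.
  induction l generalizing s with
  | nil => simp
  | cons a l ih =>
    have hB := I.B_pos
    rw [List.foldl_cons]
    by_cases h : I.c a ≤ I.B / t * I.marginal a s.out.winners ∧
        0 ≤ s.budgetLeft - I.B / t * I.marginal a s.out.winners
    · have hw : (postedStep I t s a).out.winners = insert a s.out.winners := by
        simp [postedStep, h.1, sub_nonneg.1 h.2]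
      have hb : (postedStep I t s a).budgetLeft =
          s.budgetLeft - I.B / t * I.marginal a s.out.winners := by
        simp [postedStep, h.1, sub_nonneg.1 h.2]
      obtain ⟨h1, h2⟩ := ih (postedStep I t s a) (by
        rw [hw, hb, I.v_insert, mul_add, hs]
        field_simp
        ring)
      rw [hw] at h1
      refine ⟨(Finset.subset_insert _ _).trans h1, h2.imp_right fun h2 i hi hiS => ?_⟩
      rcases List.mem_cons.1 hi with rfl | hi
      · exact absurd (h1 (Finset.mem_insert_self _ _)) hiS
      · exact h2 i hi hiS
    · have hst : postedStep I t s a = s := by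
        simp only [postedStep]
        rw [if_neg h]
      rw [hst]
      obtain ⟨h1, h2⟩ := ih s hs
      refine ⟨h1, ?_⟩
      rcases h2 with h2 | h2
      · exact Or.inl h2
      rw [not_and_or, not_le, not_le] at h
      rcases h with h | h
      · refine Or.inr fun i hi hiS => ?_
        rcases List.mem_cons.1 hi with rfl | hi
        · have h3 : I.B * I.marginal i s.out.winners < t * I.c i := by
            rw [div_mul_eq_mul_div, div_lt_iff₀ ht] at h
            linarith
          exact (mul_le_mul_of_nonneg_left (I.marginal_anti h1 hiS) hB.le).trans h3.le
        · exact h2 i hi hiS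
      · left
        -- The remaining budget is below one price, hence below B * M / t; by the invariant the
        -- value hired is within M of t.
        have h3 : t * s.budgetLeft < I.B * I.marginal a s.out.winners := by
          rw [div_mul_eq_mul_div, sub_neg, lt_div_iff₀ ht] at h
          linarith
        have h4 := mul_le_mul_of_nonneg_left
          ((I.marginal_le_singleton a s.out.winners).trans (hM a)) hB.le
        have h5 : I.B * (t - M) ≤ I.B * I.v s.out.winners := by
          rw [hs]; linarith
        exact (le_of_mul_le_mul_left h5 hB).trans (I.v_mono _ _ h1)

/-- The value hired by the posted-price procedure with threshold `t > 0`. -/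
theorem postedPrice_value {n : ℕ} (I : ProcInstance n) {t M : ℝ} (ht : 0 < t)
    (hM : ∀ i, I.v {i} ≤ M) (l : List (Fin n)) {T : Finset (Fin n)} (hT : I.Feasible T)
    (hTl : ∀ i ∈ T, i ∈ l) :
    t - M ≤ I.v (postedPrice I t l).winners ∨ I.v T - t ≤ I.v (postedPrice I t l).winners := by
  have hB := I.B_pos
  refine (postedStep_foldl_spec I ht hM l ⟨Outcome.none n, I.B⟩
    (by simp [Outcome.none, I.v_empty])).2.imp_right fun h => ?_
  change I.v T - t ≤ I.v (l.foldl (postedStep I t) ⟨Outcome.none n, I.B⟩).out.winners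
  set S := (l.foldl (postedStep I t) ⟨Outcome.none n, I.B⟩).out.winners
  have h1 : I.v T ≤ I.v S + ∑ i ∈ T, I.marginal i S :=
    (I.v_mono _ _ Finset.subset_union_right).trans (I.v_union_le S T)
  have h2 : I.B * ∑ i ∈ T, I.marginal i S ≤ I.B * t := by
    calc I.B * ∑ i ∈ T, I.marginal i S = ∑ i ∈ T, I.B * I.marginal i S := Finset.mul_sum _ _ _
      _ ≤ ∑ i ∈ T, t * I.c i := Finset.sum_le_sum fun i hi => by
          by_cases hiS : i ∈ S
          · simpa [ProcInstance.marginal, Finset.insert_eq_of_mem hiS] using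
              mul_nonneg ht.le (I.c_pos i).le
          · exact h i (hTl i hi) hiS
      _ = t * ∑ i ∈ T, I.c i := (Finset.mul_sum _ _ _).symm
      _ ≤ t * I.B := mul_le_mul_of_nonneg_left hT ht.le
      _ = I.B * t := mul_comm _ _
  linarith [le_of_mul_le_mul_left h2 hB]

/-! ### Expectations over finite random choices -/

section Expectation

variable {n : ℕ} (I : ProcInstance n)

theorem expectedValue_bind {α : Type*} [Fintype α] (P : PMF α) (f : α → PMF (Outcome n)) :
    expectedValue I (P.bind f) = ∑ a, (P a).toReal * expectedValue I (f a) := by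
  simp only [expectedValue, PMF.map_bind, PMF.bind_apply, tsum_fintype, Finset.mul_sum]
  rw [Finset.sum_comm]
  refine Finset.sum_congr rfl fun S _ => ?_
  rw [ENNReal.toReal_sum fun a _ => ENNReal.mul_ne_top (PMF.apply_ne_top _ _)
    (PMF.apply_ne_top _ _), Finset.sum_mul]
  exact Finset.sum_congr rfl fun a _ => by rw [ENNReal.toReal_mul, mul_assoc]

open Classical in
theorem expectedValue_pure (o : Outcome n) : expectedValue I (PMF.pure o) = I.v o.winners := by
  simp only [expectedValue, PMF.pure_map, PMF.pure_apply]
  rw [Finset.sum_eq_single o.winners] <;> simp +contextual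

theorem expectedValue_map {α : Type*} [Fintype α] (P : PMF α) (f : α → Outcome n) :
    expectedValue I (P.map f) = ∑ a, (P a).toReal * I.v (f a).winners := by
  simp only [← PMF.bind_pure_comp, expectedValue_bind, Function.comp, expectedValue_pure]

theorem coin_true (r : unitInterval) : (coin r true).toReal = r := by
  simp [coin, PMF.bernoulli]

theorem coin_false (r : unitInterval) : (coin r false).toReal = 1 - r := by
  have h : (coin r true + coin r false).toReal = 1 := by
    have := (coin r).tsum_coe
    rw [tsum_fintype, Fintype.sum_bool] at this
    simp [this]
  rw [ENNReal.toReal_add (PMF.apply_ne_top _ _) (PMF.apply_ne_top _ _), coin_true] at h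
  linarith

theorem binomial_half_toReal (k : Fin (n + 1)) (h : (1 / 2 : NNReal) ≤ 1) :
    (PMF.binomial (1 / 2) h n k).toReal = (n.choose k : ℝ) / 2 ^ n := by
  have h2 : (1 - (1 / 2 : NNReal)) = 1 / 2 := by
    rw [tsub_eq_iff_eq_add_of_le h]; norm_num
  have hk : (k : ℕ) + (n - k) = n := by omega
  have : PMF.binomial (1 / 2) h n k =
      (((1 / 2 : NNReal) ^ n * (n.choose k : ℕ) : NNReal) : ENNReal) := by
    simp only [PMF.binomial, PMF.ofFintype_apply, h2, Fin.val_last]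
    rw [← pow_add, hk]
  rw [this]
  simp [div_eq_mul_inv, mul_comm]

theorem expectedValue_randomOrder (M : List (Fin n) → PMF (Outcome n)) :
    expectedValue I (randomOrder M) =
      (∑ π : Equiv.Perm (Fin n), expectedValue I (M (List.ofFn π))) / n.factorial := by
  simp [randomOrder, expectedValue_bind, PMF.uniformOfFintype_apply, Fintype.card_perm,
    div_eq_inv_mul, Finset.mul_sum]

end Expectation

/-! ### Random subsets and random permutations -/

section Averaging

/-- The deviation of a uniformly random subset sum from its mean, squared and summed over
all subsets. -/
theorem sum_powerset_sq_dev {α : Type*} [DecidableEq α] (w : α → ℝ) (s : Finset α) :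
    ∑ R ∈ s.powerset, (∑ i ∈ R, w i - (∑ i ∈ s, w i) / 2) ^ 2 =
      2 ^ s.card / 4 * ∑ i ∈ s, w i ^ 2 := by
  induction s using Finset.induction_on with
  | empty => simp
  | insert a s ha ih =>
    rw [Finset.sum_powerset_insert ha, ← Finset.sum_add_distrib, Finset.sum_insert ha,
      Finset.sum_insert ha, Finset.card_insert_of_notMem ha]
    have h : ∀ R ∈ s.powerset,
        (∑ i ∈ R, w i - (w a + ∑ i ∈ s, w i) / 2) ^ 2 +
          (∑ i ∈ insert a R, w i - (w a + ∑ i ∈ s, w i) / 2) ^ 2 =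
        2 * (∑ i ∈ R, w i - (∑ i ∈ s, w i) / 2) ^ 2 + w a ^ 2 / 2 := fun R hR => by
      rw [Finset.sum_insert fun h => ha (Finset.mem_powerset.1 hR h)]
      ring
    rw [Finset.sum_congr rfl h, Finset.sum_add_distrib, ← Finset.mul_sum, ih,
      Finset.sum_const, Finset.card_powerset, nsmul_eq_mul]
    push_cast
    ring

theorem exists_perm_image_eq {α : Type*} [Fintype α] [DecidableEq α] {K R : Finset α}
    (h : K.card = R.card) : ∃ σ : Equiv.Perm α, K.image σ = R := by
  refine ⟨(Finset.equivOfCardEq h).extendSubtype,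
    Finset.eq_of_subset_of_card_le (fun x hx => ?_) ?_⟩
  · obtain ⟨y, hy, rfl⟩ := Finset.mem_image.1 hx
    exact (Finset.equivOfCardEq h).extendSubtype_mem y hy
  · rw [Finset.card_image_of_injective _ (Equiv.injective _), h]

/-- The image of a fixed set under a uniformly random permutation is uniformly distributed
among the sets of its size. -/
theorem sum_perm_image {α : Type*} [Fintype α] [DecidableEq α] (K : Finset α)
    (G : Finset α → ℝ) :
    ((Fintype.card α).choose K.card : ℝ) * ∑ π : Equiv.Perm α, G (K.image π) =
      (Fintype.card α).factorial * ∑ R ∈ Finset.univ.powersetCard K.card, G R := by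
  -- Double counting over pairs (R, π): the sum over π does not depend on R (`h1`), and the sum over
  -- R does not depend on π (`h2`).
  have h1 : ∀ R ∈ Finset.univ.powersetCard K.card,
      ∑ π : Equiv.Perm α, G (R.image π) = ∑ π : Equiv.Perm α, G (K.image π) := fun R hR => by
    obtain ⟨σ, rfl⟩ := exists_perm_image_eq (Finset.mem_powersetCard.1 hR).2.symm
    refine Fintype.sum_equiv (Equiv.mulRight σ) _ _ fun π => ?_
    rw [Finset.image_image]
    rfl
  have h2 : ∀ π : Equiv.Perm α, ∑ R ∈ Finset.univ.powersetCard K.card, G (R.image π) =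
      ∑ R ∈ Finset.univ.powersetCard K.card, G R := fun π => by
    refine Finset.sum_bij' (fun R _ => R.image π) (fun R _ => R.image π.symm) ?_ ?_ ?_ ?_ ?_
    · intro R hR
      simpa [Finset.mem_powersetCard, Finset.card_image_of_injective _ π.injective] using hR
    · intro R hR
      simpa [Finset.mem_powersetCard, Finset.card_image_of_injective _ π.symm.injective] using hR
    · intro R _; simp [Finset.image_image]
    · intro R _; simp [Finset.image_image]
    · intro R _; rfl
  calc ((Fintype.card α).choose K.card : ℝ) * ∑ π : Equiv.Perm α, G (K.image π)
      = ∑ R ∈ Finset.univ.powersetCard K.card, ∑ π : Equiv.Perm α, G (R.image π) := by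
        rw [Finset.sum_congr rfl h1, Finset.sum_const, Finset.card_powersetCard,
          Finset.card_univ, nsmul_eq_mul]
    _ = _ := by
        rw [Finset.sum_comm, Finset.sum_congr rfl fun π _ => h2 π, Finset.sum_const,
          Finset.card_univ, Fintype.card_perm, nsmul_eq_mul]

variable {n : ℕ}

theorem toFinset_take_ofFn (π : Equiv.Perm (Fin n)) (k : ℕ) :
    ((List.ofFn π).take k).toFinset =
      (Finset.univ.filter fun i : Fin n => (i : ℕ) < k).image π := by
  ext x
  simp only [List.mem_toFinset, List.mem_take_iff_getElem, Finset.mem_image, Finset.mem_filter,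
    Finset.mem_univ, true_and, List.getElem_ofFn, List.length_ofFn]
  constructor
  · rintro ⟨i, hi, rfl⟩
    exact ⟨⟨i, by omega⟩, by simp; omega, rfl⟩
  · rintro ⟨i, hi, rfl⟩
    exact ⟨i, by omega, rfl⟩

theorem mem_ofFn_perm (π : Equiv.Perm (Fin n)) (i : Fin n) : i ∈ List.ofFn π :=
  List.mem_ofFn.2 (π.surjective i)

theorem mem_drop_ofFn {π : Equiv.Perm (Fin n)} {k : ℕ} {i : Fin n}
    (h : i ∉ (List.ofFn π).take k) : i ∈ (List.ofFn π).drop k := by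
  have h1 := mem_ofFn_perm π i
  rw [← List.take_append_drop k (List.ofFn π), List.mem_append] at h1
  exact h1.resolve_left h

theorem sum_perm_take {k : ℕ} (hk : k ≤ n) (G : Finset (Fin n) → ℝ) :
    (n.choose k : ℝ) * ∑ π : Equiv.Perm (Fin n), G ((List.ofFn π).take k).toFinset =
      n.factorial * ∑ R ∈ Finset.univ.powersetCard k, G R := by
  have hc : (Finset.univ.filter fun i : Fin n => (i : ℕ) < k).card = k := by
    rw [Fin.card_filter_val_lt, min_eq_right hk]
  have := sum_perm_image (Finset.univ.filter fun i : Fin n => (i : ℕ) < k) G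
  rw [hc, Fintype.card_fin] at this
  simpa only [toFinset_take_ofFn] using this

/-- Sampling a binomially distributed number of agents in random order yields a uniformly
random set. -/
theorem sum_perm_binomial (G : Finset (Fin n) → ℝ) :
    (∑ π : Equiv.Perm (Fin n), ∑ k : Fin (n + 1),
        (n.choose k : ℝ) / 2 ^ n * G ((List.ofFn π).take k).toFinset) / n.factorial =
      (∑ R : Finset (Fin n), G R) / 2 ^ n := by
  have hf : (n.factorial : ℝ) ≠ 0 := by exact_mod_cast n.factorial_ne_zero
  have h : ∀ k : Fin (n + 1), ∑ π : Equiv.Perm (Fin n),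
      (n.choose k : ℝ) / 2 ^ n * G ((List.ofFn π).take k).toFinset =
      n.factorial * (∑ R ∈ Finset.univ.powersetCard (k : ℕ), G R) / 2 ^ n := fun k => by
    rw [← sum_perm_take (Nat.lt_succ_iff.1 k.2), ← Finset.mul_sum]
    ring
  rw [Finset.sum_comm, Finset.sum_congr rfl fun k _ => h k, ← Finset.sum_div, ← Finset.mul_sum,
    ← Finset.powerset_univ, Finset.sum_powerset, Finset.card_univ, Fintype.card_fin,
    Finset.sum_range]
  field_simp

theorem choose_le_card_separating {s b : Fin n} (hsb : s ≠ b) (k : ℕ) :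
    (n - 2).choose k ≤
      ((Finset.univ.powersetCard (k + 1)).filter fun R : Finset (Fin n) => s ∈ R ∧ b ∉ R).card := by
  have hc : ((Finset.univ.erase b).erase s).card = n - 2 := by
    rw [Finset.card_erase_of_mem (by simp [hsb]), Finset.card_erase_of_mem (Finset.mem_univ _),
      Finset.card_univ, Fintype.card_fin]
    rfl
  rw [← hc, ← Finset.card_powersetCard]
  have hs : ∀ R ∈ ((Finset.univ.erase b).erase s).powersetCard k, s ∉ R := fun R hR h => by
    simpa using (Finset.mem_powersetCard.1 hR).1 h
  refine Finset.card_le_card_of_injOn (insert s) (fun R hR => ?_) fun R hR R' hR' h => ?_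
  · have hR1 := Finset.mem_powersetCard.1 hR
    have hb : b ∉ R := fun h => by simpa using hR1.1 h
    simp [Finset.mem_powersetCard, Finset.card_insert_of_notMem (hs R hR), hR1.2, hsb.symm, hb]
  · rw [← Finset.erase_insert (hs R hR), ← Finset.erase_insert (hs R' hR')]
    exact congrArg (fun S => Finset.erase S s) h

/-- With n = m + 2 agents and sample size r = k + 1, the ratio of the two binomial coefficients is
the probability that one given agent is sampled and another is not; this evaluates it as r(n - r) /
(n(n - 1)). -/
theorem choose_mul_sub (m k : ℕ) :
    (m + 2).choose (k + 1) * ((k + 1) * (m + 1 - k)) = (m + 2) * (m + 1) * m.choose k := by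
  have h1 := Nat.add_one_mul_choose_eq (m + 1) k
  have h2 := Nat.choose_mul_succ_eq m k
  calc (m + 2).choose (k + 1) * ((k + 1) * (m + 1 - k))
      = ((m + 2).choose (k + 1) * (k + 1)) * (m + 1 - k) := by ring
    _ = (m + 2) * ((m + 1).choose k * (m + 1 - k)) := by rw [← h1]; ring
    _ = _ := by rw [← h2]; ring

end Averaging

/-! ### Dynkin's algorithm -/

section Dynkin

/-- Bounds from below the probability that the second best agent is sampled and the best is not. Its
limit (1 - 1/e)/e is about 0.23; the constant 0.18 leaves room for small n. -/
theorem floor_div_exp_bound {n : ℕ} (h : 1 ≤ ⌊(n : ℝ) / Real.exp 1⌋₊) :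
    0.18 * ((n : ℝ) * (n - 1)) ≤
      (⌊(n : ℝ) / Real.exp 1⌋₊ : ℝ) * (n - ⌊(n : ℝ) / Real.exp 1⌋₊) := by
  have he1 := Real.exp_one_gt_d9
  have he2 := Real.exp_one_lt_d9
  have hn : (0 : ℝ) ≤ n := Nat.cast_nonneg n
  have h1 : (⌊(n : ℝ) / Real.exp 1⌋₊ : ℝ) ≤ 0.3679 * n := by
    refine (Nat.floor_le (by positivity)).trans ?_
    rw [div_le_iff₀ (Real.exp_pos 1)]
    nlinarith
  have h2 : 0.3678 * n - 1 ≤ (⌊(n : ℝ) / Real.exp 1⌋₊ : ℝ) := by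
    have h3 : 0.3678 * n ≤ (n : ℝ) / Real.exp 1 := by
      rw [le_div_iff₀ (Real.exp_pos 1)]
      nlinarith
    linarith [Nat.lt_floor_add_one ((n : ℝ) / Real.exp 1)]
  have h' : (1 : ℝ) ≤ (⌊(n : ℝ) / Real.exp 1⌋₊ : ℝ) := by exact_mod_cast h
  generalize (⌊(n : ℝ) / Real.exp 1⌋₊ : ℝ) = r at *
  rcases le_or_gt n 5 with h5 | h5
  · have h5' : (n : ℝ) ≤ 5 := by exact_mod_cast h5
    -- By concavity of r(n - r), its value for r between 1 and n - 1 is at least n - 1. For large n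
    -- the same argument runs between 0.3678 n - 1 and its reflection.
    have h6 : 0 ≤ (r - 1) * (n - 1 - r) := mul_nonneg (by linarith) (by linarith)
    have h7 : 0 ≤ ((n : ℝ) - 1) * (5 - n) := mul_nonneg (by linarith) (by linarith)
    nlinarith
  · have h5' : (6 : ℝ) ≤ n := by exact_mod_cast h5
    have h6 : 0 ≤ (r - (0.3678 * n - 1)) * (n - r - (0.3678 * n - 1)) :=
      mul_nonneg (by linarith) (by linarith)
    nlinarith

variable {n : ℕ} (I : ProcInstance n) (tie : Equiv.Perm (Fin n))

/-- The key by which `Beats` compares agents. -/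
def ProcInstance.key (i : Fin n) : ℝ ×ₗ Fin n := toLex (I.v {i}, tie i)

theorem ProcInstance.beats_iff (i j : Fin n) :
    I.Beats tie j i ↔ I.key tie i < I.key tie j := by
  simp [Beats, key, Prod.Lex.toLex_lt_toLex]

theorem ProcInstance.key_injective : Function.Injective (I.key tie) := fun _ _ h =>
  tie.injective (congrArg Prod.snd (toLex.injective h))

theorem ProcInstance.v_le_of_key_le {i j : Fin n} (h : I.key tie i ≤ I.key tie j) :
    I.v {i} ≤ I.v {j} := by
  rcases Prod.Lex.toLex_le_toLex.1 h with h | h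
  · exact h.le
  · exact h.1.le

theorem find?_eq_some_of_unique {α : Type*} {q : α → Bool} {l : List α} {b : α} (hb : b ∈ l)
    (hq : q b = true) (h : ∀ x, q x = true → x = b) : l.find? q = some b := by
  rcases hf : l.find? q with _ | x
  · exact absurd hq (List.find?_eq_none.1 hf b hb)
  · rw [h x (List.find?_some hf)]

/-- Dynkin's algorithm hires the best agent if she is not sampled but the second best is. -/
theorem dynkin_winners_of_separated {b s : Fin n} (hb : ∀ i, I.key tie i ≤ I.key tie b)
    (hs : ∀ i, i ≠ b → I.key tie i ≤ I.key tie s) (π : Equiv.Perm (Fin n))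
    (h : s ∈ (List.ofFn π).take ⌊(n : ℝ) / Real.exp 1⌋₊ ∧
      b ∉ (List.ofFn π).take ⌊(n : ℝ) / Real.exp 1⌋₊) :
    (dynkin I tie (List.ofFn π)).winners = {b} := by
  simp only [dynkin]
  generalize ⌊(n : ℝ) / Real.exp 1⌋₊ = r at *
  rw [find?_eq_some_of_unique (b := b) (mem_drop_ofFn h.2)]
  · rfl
  · simp only [decide_eq_true_eq]
    refine fun i hi => (I.beats_iff tie i b).2 ((hb i).lt_of_ne fun h' => ?_)
    exact h.2 (I.key_injective tie h' ▸ hi)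
  · intro x hx
    simp only [decide_eq_true_eq] at hx
    by_contra hne
    exact absurd (hs x hne) (not_le.2 ((I.beats_iff tie s x).1 (hx s h.1)))

theorem dynkin_winners_of_floor_eq_zero (h : ⌊(n : ℝ) / Real.exp 1⌋₊ = 0) (hn : 0 < n)
    (π : Equiv.Perm (Fin n)) :
    (dynkin I tie (List.ofFn π)).winners = ((List.ofFn π).take 1).toFinset := by
  obtain ⟨m, rfl⟩ := Nat.exists_eq_add_of_lt hn
  simp only [dynkin]
  generalize ⌊((0 + m + 1 : ℕ) : ℝ) / Real.exp 1⌋₊ = r at *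
  subst h
  simp [hireSingle, List.ofFn_succ]

/-- In expectation over the arrival order, Dynkin's algorithm hires a constant fraction of the
value of every single agent. -/
theorem dynkin_value (i : Fin n) :
    0.18 * I.v {i} ≤
      (∑ π : Equiv.Perm (Fin n), I.v (dynkin I tie (List.ofFn π)).winners) / n.factorial := by
  have hn : 0 < n := i.pos
  have hf : (0 : ℝ) < n.factorial := by exact_mod_cast n.factorial_pos
  obtain ⟨b, -, hb⟩ := Finset.exists_max_image Finset.univ (I.key tie) ⟨i, Finset.mem_univ i⟩
  replace hb : ∀ i, I.key tie i ≤ I.key tie b := fun i => hb i (Finset.mem_univ i)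
  have hvb := I.v_nonneg {b}
  refine (mul_le_mul_of_nonneg_left (I.v_le_of_key_le tie (hb i)) (by norm_num)).trans ?_
  rw [le_div_iff₀ hf]
  rcases Nat.eq_zero_or_pos ⌊(n : ℝ) / Real.exp 1⌋₊ with h0 | h0
  -- Empty sample: since e < 3 there are at most two agents, and the first to arrive is the best
  -- with probability at least 1/2.
  · have hn2 : (n : ℝ) ≤ 2 := by
      have h1 := Nat.floor_eq_zero.1 h0
      rw [div_lt_one (Real.exp_pos 1)] at h1
      have h2 : (n : ℝ) < (3 : ℕ) := by push_cast; linarith [Real.exp_one_lt_d9]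
      exact_mod_cast Nat.lt_succ_iff.1 (Nat.cast_lt.1 h2)
    have h1 := sum_perm_take (n := n) hn I.v
    rw [Finset.sum_congr rfl fun π _ =>
      congrArg I.v (dynkin_winners_of_floor_eq_zero I tie h0 hn π)]
    have h2 : I.v {b} ≤ ∑ R ∈ Finset.univ.powersetCard 1, I.v R :=
      Finset.single_le_sum (f := I.v) (fun R _ => I.v_nonneg R) (by simp)
    have h3 := mul_le_mul_of_nonneg_left h2 hf.le
    rw [← h1, Nat.choose_one_right] at h3
    have h4 : 0 ≤ ∑ π : Equiv.Perm (Fin n), I.v ((List.ofFn π).take 1).toFinset :=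
      Finset.sum_nonneg fun _ _ => I.v_nonneg _
    nlinarith [mul_nonneg hvb hf.le]
  · have hn2 : 2 ≤ n := by
      by_contra hlt
      have h1 : n = 1 := by omega
      have h2 := (Nat.le_floor_iff (by positivity)).1 (Nat.succ_le_of_lt h0)
      rw [le_div_iff₀ (Real.exp_pos 1), h1] at h2
      norm_num at h2
    have hne : (Finset.univ.erase b).Nonempty := by
      rw [← Finset.card_pos, Finset.card_erase_of_mem (Finset.mem_univ b), Finset.card_univ,
        Fintype.card_fin]
      omega
    obtain ⟨s, hsb, hs⟩ := Finset.exists_max_image _ (I.key tie) hne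
    replace hs : ∀ i, i ≠ b → I.key tie i ≤ I.key tie s := fun i hi => hs i (by simp [hi])
    have hsb : s ≠ b := Finset.ne_of_mem_erase hsb
    have hr := floor_div_exp_bound h0
    have hd := dynkin_winners_of_separated I tie hb hs
    have hrn : ⌊(n : ℝ) / Real.exp 1⌋₊ ≤ n := by
      refine Nat.floor_le_of_le (div_le_self (by positivity) ?_)
      linarith [Real.exp_one_gt_d9]
    obtain ⟨k, hk⟩ := Nat.exists_eq_add_of_le' h0
    obtain ⟨m, rfl⟩ := Nat.exists_eq_add_of_le' hn2
    rw [hk] at hr hd hrn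
    set G : Finset (Fin (m + 2)) → ℝ := fun R => if s ∈ R ∧ b ∉ R then I.v {b} else 0 with hG
    have h1 : ∑ π : Equiv.Perm (Fin (m + 2)), G ((List.ofFn π).take (k + 1)).toFinset ≤
        ∑ π : Equiv.Perm (Fin (m + 2)), I.v (dynkin I tie (List.ofFn π)).winners := by
      refine Finset.sum_le_sum fun π _ => ?_
      simp only [hG, List.mem_toFinset]
      split_ifs with h
      · rw [hd π h]
      · exact I.v_nonneg _
    have h2 := sum_perm_take hrn G
    have h3 : ((m.choose k : ℕ) : ℝ) * I.v {b} ≤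
        ∑ R ∈ Finset.univ.powersetCard (k + 1), G R := by
      rw [hG, ← Finset.sum_filter, Finset.sum_const, nsmul_eq_mul]
      exact mul_le_mul_of_nonneg_right (by exact_mod_cast choose_le_card_separating hsb k) hvb
    have h4 : ((m + 2).choose (k + 1) : ℝ) * ((k + 1) * (m + 1 - k)) =
        (m + 2) * (m + 1) * m.choose k := by
      have hkm : k ≤ m + 1 := by omega
      have := congrArg (Nat.cast (R := ℝ)) (choose_mul_sub m k)
      push_cast [Nat.cast_sub hkm] at this
      exact this
    have hc : (0 : ℝ) < (m + 2).choose (k + 1) := by exact_mod_cast Nat.choose_pos hrn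
    have h5 : 0.18 * ((m + 2).choose (k + 1) : ℝ) ≤ m.choose k := by
      have hm : (0 : ℝ) < (m + 2) * (m + 1) := by positivity
      refine le_of_mul_le_mul_left ?_ hm
      rw [← h4]
      push_cast at hr
      nlinarith [mul_le_mul_of_nonneg_left hr hc.le]
    refine le_trans ?_ h1
    refine le_of_mul_le_mul_left ?_ hc
    rw [h2]
    nlinarith [mul_le_mul_of_nonneg_left h3 hf.le,
      mul_le_mul_of_nonneg_right h5 (mul_nonneg hf.le hvb)]

end Dynkin

/-! ### Guarantees of the two mechanisms -/

variable {n : ℕ} (I : ProcInstance n)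

/-- If some agent reaches the value aω/z, the single hire suffices because pa/z > 1/6. Otherwise M
can be taken as aω/z, and the two alternatives of `postedPrice_value` suffice because (1-p)a(1 -
1/z) and (1-p)(1-a) both exceed 1/6. -/
theorem predMechanism_value {Sopt : Finset (Fin n)} (hS : I.Feasible Sopt)
    {ε : ℝ} (hε0 : 0 < ε) (hε1 : ε < 1) (hV : 0 < I.v Sopt) {l : List (Fin n)}
    (hl : ∀ i, i ∈ l) (p : unitInterval) (hp : (p : ℝ) = 0.46) :
    1 / 6 * (1 - ε) * I.v Sopt ≤
      expectedValue I (predMechanism I ((1 - ε) * I.v Sopt) p 0.685 1.85 l) := by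
  have hω : 0 < (1 - ε) * I.v Sopt := mul_pos (by linarith) hV
  have hωV : (1 - ε) * I.v Sopt ≤ I.v Sopt := by nlinarith
  rw [mul_assoc]
  generalize (1 - ε) * I.v Sopt = ω at *
  simp only [predMechanism, expectedValue_map, Fintype.sum_bool, coin_true, coin_false, hp,
    if_true, Bool.false_eq_true, if_false]
  have hA := I.v_nonneg (postedPrice I (0.685 * ω) l).winners
  have hF := I.v_nonneg (firstAbove I (0.685 * ω / 1.85) l).winners
  by_cases h : ∃ j, 0.685 * ω / 1.85 ≤ I.v {j}
  · obtain ⟨j, hj⟩ := h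
    have hw : 0.685 * ω / 1.85 ≤ I.v (firstAbove I (0.685 * ω / 1.85) l).winners := by
      simp only [firstAbove]
      generalize hq : l.find? _ = o
      rcases o with _ | x
      · exact absurd (decide_eq_true hj) (List.find?_eq_none.1 hq j (hl j))
      · exact of_decide_eq_true (List.find?_some hq :)
    norm_num at hw ⊢
    nlinarith
  · push Not at h
    have := postedPrice_value I (t := 0.685 * ω) (M := 0.685 * ω / 1.85) (by positivity)
      (fun i => (h i).le) l hS fun i _ => hl i
    generalize I.v (postedPrice I (0.685 * ω) l).winners = A at *
    generalize I.v (firstAbove I (0.685 * ω / 1.85) l).winners = F at *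
    norm_num at this ⊢
    rcases this with h | h <;> linarith

/-- The posted-price procedure with a sampled threshold, when the sampled part `R` of the optimum
carries about half of its value. -/
theorem postedPrice_sample_value {Sopt : Finset (Fin n)} (hS : I.IsOptimal Sopt)
    (hV : 0 < I.v Sopt) {M : ℝ} (hM : ∀ i, I.v {i} ≤ M) {R T : Finset (Fin n)}
    (hT : I.IsApproxSolution (1 - 1 / Real.exp 1) R T) {l : List (Fin n)}
    (hl : ∀ i, i ∉ R → i ∈ l) (h1 : 0.33 * I.v Sopt ≤ I.v (Sopt ∩ R))
    (h2 : 0.33 * I.v Sopt ≤ I.v (Sopt \ R)) :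
    min (0.0604 * I.v Sopt - M) (0.04 * I.v Sopt) ≤
      I.v (postedPrice I (0.29 * I.v T) l).winners := by
  -- The threshold lies between 0.29 * 0.632 * 0.33 V > 0.0604 V and 0.29 V, and 0.33 - 0.29 = 0.04.
  have he : (0.632 : ℝ) ≤ 1 - 1 / Real.exp 1 := by
    have : 1 / Real.exp 1 ≤ 0.368 := by
      rw [div_le_iff₀ (Real.exp_pos 1)]
      linarith [Real.exp_one_gt_d9]
    linarith
  have hT1 := hT.2.2 (Sopt ∩ R) Finset.inter_subset_right
    (I.feasible_mono Finset.inter_subset_left hS.1)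
  have hT2 : 0.632 * (0.33 * I.v Sopt) ≤ I.v T :=
    (mul_le_mul he h1 (by positivity) (by linarith)).trans hT1
  have hT3 := hS.2 T hT.2.1
  rcases postedPrice_value I (t := 0.29 * I.v T) (by nlinarith) hM l
    (I.feasible_mono (Finset.sdiff_subset (s := Sopt) (t := R)) hS.1)
    (fun i hi => hl i (Finset.mem_sdiff.1 hi).2) with h | h
  · exact (min_le_left _ _).trans (by linarith)
  · exact (min_le_right _ _).trans (by linarith)

/-- The posted-price procedure with a sampled threshold, in expectation over the sample. -/
theorem postedPrice_sample_expectation {Sopt : Finset (Fin n)} (hS : I.IsOptimal Sopt)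
    (hV : 0 < I.v Sopt) {M : ℝ} (hM : ∀ i, I.v {i} ≤ M) (hMV : M ≤ 0.0604 * I.v Sopt)
    {T₁ : Finset (Fin n) → Finset (Fin n)}
    (hT₁ : ∀ R, I.IsApproxSolution (1 - 1 / Real.exp 1) R (T₁ R)) :
    min (0.0604 * I.v Sopt - M) (0.04 * I.v Sopt) * (1 - M / (0.1156 * I.v Sopt)) ≤
      (∑ π : Equiv.Perm (Fin n), ∑ k : Fin (n + 1), (n.choose k : ℝ) / 2 ^ n *
        I.v (postedPrice I (0.29 * I.v (T₁ ((List.ofFn π).take k).toFinset))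
          ((List.ofFn π).drop k)).winners) / n.factorial := by
  obtain ⟨w, hw0, hw1, hw2, hw3⟩ := I.exists_additive_minorant Sopt
  set V := I.v Sopt with hVdef
  set g := min (0.0604 * V - M) (0.04 * V) with hg
  have hg0 : 0 ≤ g := le_min (by linarith) (by positivity)
  set u : Fin n → ℝ := fun i => if i ∈ Sopt then w i else 0 with hu
  have hR : ∀ R : Finset (Fin n), ∑ i ∈ R, u i = ∑ i ∈ Sopt ∩ R, w i := fun R => by
    rw [hu, Finset.sum_ite_mem, Finset.inter_comm]
  have huV : ∑ i, u i = V := by rw [hR, Finset.inter_univ, hw2]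
  -- Each weight is at most M, so the sum of the squared weights is at most M V.
  have hvar : ∑ R : Finset (Fin n), (∑ i ∈ R, u i - V / 2) ^ 2 ≤ 2 ^ n / 4 * (M * V) := by
    have h := sum_powerset_sq_dev u Finset.univ
    rw [Finset.powerset_univ, huV, Finset.card_univ, Fintype.card_fin] at h
    rw [h]
    refine mul_le_mul_of_nonneg_left ?_ (by positivity)
    rw [← huV, Finset.mul_sum]
    refine Finset.sum_le_sum fun i _ => ?_
    by_cases hi : i ∈ Sopt
    · simp only [hu, hi, if_true, sq]
      exact mul_le_mul_of_nonneg_right ((hw1 i).trans (hM i)) (hw0 i)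
    · simp [hu, hi]
  -- Chebyshev in pointwise form: a quadratic that is at most g everywhere and nonpositive once the
  -- deviation reaches 0.17 V. Here 0.17 = 0.5 - 0.33, and 0.1156 = 4 * 0.17 ^ 2.
  set G : Finset (Fin n) → ℝ := fun R =>
    g - g / (0.17 * V) ^ 2 * (∑ i ∈ R, u i - V / 2) ^ 2 with hG
  have hpt : ∀ (π : Equiv.Perm (Fin n)) (k : ℕ), G ((List.ofFn π).take k).toFinset ≤
      I.v (postedPrice I (0.29 * I.v (T₁ ((List.ofFn π).take k).toFinset))
          ((List.ofFn π).drop k)).winners := fun π k => by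
    have hl : ∀ i, i ∉ ((List.ofFn π).take k).toFinset → i ∈ (List.ofFn π).drop k :=
      fun i hi => mem_drop_ofFn (by simpa using hi)
    have hp0 : 0 ≤ g / (0.17 * V) ^ 2 := by positivity
    generalize ((List.ofFn π).take k).toFinset = R at *
    by_cases hd : |∑ i ∈ R, u i - V / 2| ≤ 0.17 * V
    · have h1 := abs_le.1 hd
      have h2 := hw3 (Sopt ∩ R) Finset.inter_subset_left
      have h3 := hw3 (Sopt \ R) Finset.sdiff_subset
      have h4 := Finset.sum_inter_add_sum_sdiff Sopt R w
      rw [hR] at h1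
      refine le_trans ?_ (postedPrice_sample_value I hS hV hM (hT₁ R) hl
        (by rw [← hVdef]; linarith) (by rw [← hVdef]; linarith))
      have := mul_nonneg hp0 (sq_nonneg (∑ i ∈ R, u i - V / 2))
      simp only [hG]
      linarith
    · refine le_trans ?_ (I.v_nonneg _)
      have h1 : (0.17 * V) ^ 2 ≤ (∑ i ∈ R, u i - V / 2) ^ 2 := by
        rw [← sq_abs (∑ i ∈ R, u i - V / 2)]
        exact pow_le_pow_left₀ (by positivity) (not_le.1 hd).le 2
      have h2 := mul_le_mul_of_nonneg_left h1 hp0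
      rw [div_mul_cancel₀ _ (by positivity)] at h2
      simp only [hG]
      linarith
  have hmain : g * (1 - M / (0.1156 * V)) ≤ (∑ R : Finset (Fin n), G R) / 2 ^ n := by
    rw [le_div_iff₀ (by positivity)]
    simp only [hG]
    rw [Finset.sum_sub_distrib, ← Finset.mul_sum, Finset.sum_const, Finset.card_univ,
      Fintype.card_finset, Fintype.card_fin, nsmul_eq_mul]
    have h := mul_le_mul_of_nonneg_left hvar (show 0 ≤ g / (0.17 * V) ^ 2 by positivity)
    have h' : g / (0.17 * V) ^ 2 * (2 ^ n / 4 * (M * V)) = g * (M / (0.1156 * V)) * 2 ^ n := by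
      field_simp
      norm_num
      ring
    push_cast
    rw [h'] at h
    linarith
  refine hmain.trans ?_
  rw [← sum_perm_binomial]
  gcongr with π _ k _
  exact hpt π k

/-- Lets the sample size range over the finite type `Fin (n + 1)`, as `expectedValue_map` requires.
-/
theorem noPredMechanism_eq (tie : Equiv.Perm (Fin n)) (T₁ : Finset (Fin n) → Finset (Fin n))
    (q : unitInterval) (β : ℝ) (l : List (Fin n)) :
    noPredMechanism I tie T₁ q β l = (coin q).bind fun b =>
      if b then PMF.pure (dynkin I tie l)
      else PMF.map (fun k : Fin (n + 1) =>
        postedPrice I (β * I.v (T₁ (l.take k).toFinset)) (l.drop k))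
          (PMF.binomial (1 / 2) (by norm_num) n) := by
  unfold noPredMechanism
  congr 1
  funext b
  cases b
  · exact PMF.map_comp Fin.val _ _
  · rfl

/-- With d = M/V, the combined lower bound is smallest at d = 0.0604, where the posted-price bound
vanishes and Dynkin alone gives 0.66 * 0.18 * 0.0604 > 1/146. -/
theorem noPredMechanism_value {Sopt : Finset (Fin n)} (hS : I.IsOptimal Sopt)
    (hV : 0 < I.v Sopt) (tie : Equiv.Perm (Fin n)) {T₁ : Finset (Fin n) → Finset (Fin n)}
    (hT₁ : ∀ R, I.IsApproxSolution (1 - 1 / Real.exp 1) R (T₁ R)) (q : unitInterval)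
    (hq : (q : ℝ) = 0.66) :
    1 / 146 * I.v Sopt ≤ (∑ π : Equiv.Perm (Fin n),
      expectedValue I (noPredMechanism I tie T₁ q 0.29 (List.ofFn π))) / n.factorial := by
  have hne : Sopt.Nonempty := by
    rw [Finset.nonempty_iff_ne_empty]
    rintro rfl
    exact hV.ne' I.v_empty
  obtain ⟨i, -⟩ := hne
  obtain ⟨m, -, hm⟩ := Finset.exists_max_image Finset.univ (fun i => I.v {i})
    ⟨i, Finset.mem_univ i⟩
  replace hm : ∀ i, I.v {i} ≤ I.v {m} := fun i => hm i (Finset.mem_univ i)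
  have hD := dynkin_value I tie m
  have hE : ∀ π : Equiv.Perm (Fin n),
      expectedValue I (noPredMechanism I tie T₁ q 0.29 (List.ofFn π)) =
        0.66 * I.v (dynkin I tie (List.ofFn π)).winners +
        0.34 * ∑ k : Fin (n + 1), (n.choose k : ℝ) / 2 ^ n *
          I.v (postedPrice I (0.29 * I.v (T₁ ((List.ofFn π).take k).toFinset))
            ((List.ofFn π).drop k)).winners := fun π => by
    simp only [noPredMechanism_eq, expectedValue_bind, Fintype.sum_bool, coin_true, coin_false, hq,
      if_true, Bool.false_eq_true, if_false, expectedValue_pure, expectedValue_map,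
      binomial_half_toReal]
    norm_num
  simp only [hE]
  rw [Finset.sum_add_distrib, ← Finset.mul_sum, ← Finset.mul_sum, add_div, mul_div_assoc,
    mul_div_assoc]
  have hM0 := I.v_nonneg {m}
  rcases le_or_gt (I.v {m}) (0.0604 * I.v Sopt) with hMV | hMV
  · refine le_trans ?_ (add_le_add (mul_le_mul_of_nonneg_left hD (by norm_num))
      (mul_le_mul_of_nonneg_left (postedPrice_sample_expectation I hS hV hm hMV hT₁)
        (by norm_num)))
    obtain ⟨d, hd⟩ : ∃ d, I.v {m} = d * I.v Sopt := ⟨I.v {m} / I.v Sopt, by field_simp⟩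
    rw [hd] at hMV hM0 ⊢
    have hd1 : d ≤ 0.0604 := le_of_mul_le_mul_right hMV hV
    have hd0 : 0 ≤ d := nonneg_of_mul_nonneg_left hM0 hV
    have h1 : d * I.v Sopt / (0.1156 * I.v Sopt) = d / 0.1156 := by field_simp
    rw [h1]
    -- The two terms of the minimum agree at d = 0.0604 - 0.04.
    rcases le_total d 0.0204 with h2 | h2
    · rw [min_eq_right (by nlinarith)]
      have : 1 / 146 ≤ 0.66 * (0.18 * d) + 0.34 * (0.04 * (1 - d / 0.1156)) := by
        norm_num at h2 ⊢
        linarith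
      nlinarith
    · rw [min_eq_left (by nlinarith)]
      have : 1 / 146 ≤ 0.66 * (0.18 * d) + 0.34 * ((0.0604 - d) * (1 - d / 0.1156)) := by
        norm_num at h2 hd1 ⊢
        nlinarith [mul_nonneg (sub_nonneg.2 hd1) (sub_nonneg.2 hd1)]
      nlinarith
  · have hP : 0 ≤ (∑ π : Equiv.Perm (Fin n), ∑ k : Fin (n + 1), (n.choose k : ℝ) / 2 ^ n *
        I.v (postedPrice I (0.29 * I.v (T₁ ((List.ofFn π).take k).toFinset))
          ((List.ofFn π).drop k)).winners) / n.factorial :=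
      div_nonneg (Finset.sum_nonneg fun π _ => Finset.sum_nonneg fun k _ =>
        mul_nonneg (by positivity) (I.v_nonneg _)) (by positivity)
    norm_num at hD hMV hP ⊢
    linarith

theorem expectedValue_nonneg (P : PMF (Outcome n)) : 0 ≤ expectedValue I P :=
  Finset.sum_nonneg fun S _ => mul_nonneg ENNReal.toReal_nonneg (I.v_nonneg S)

end OnlineProcurement

/-! ### The combined mechanism -/

theorem mainTheorem3 {n : ℕ} (I : OnlineProcurement.ProcInstance n)
    (Sopt : Finset (Fin n)) (hSopt : I.IsOptimal Sopt)
    (τ ε : ℝ) (hτ0 : 0 ≤ τ) (hτ1 : τ < 1) (hε0 : 0 < ε) (hε1 : ε < 1)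
    (ω : ℝ) (hω : ω = (1 - ε) * I.v Sopt)
    (tie : Equiv.Perm (Fin n))
    (T₁ : Finset (Fin n) → Finset (Fin n))
    (hT₁ : ∀ N₁ : Finset (Fin n), I.IsApproxSolution (1 - 1 / Real.exp 1) N₁ (T₁ N₁)) :
    (τ * (1 / 6 * (1 - ε)) + (1 - τ) * (1 / 146))⁻¹ *
        OnlineProcurement.expectedValue I
          (OnlineProcurement.randomOrder
            (OnlineProcurement.combinedMechanism I ω ⟨τ, hτ0, hτ1.le⟩
              ⟨0.46, by norm_num, by norm_num⟩ 0.685 1.85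
              tie T₁ ⟨0.66, by norm_num, by norm_num⟩ 0.29))
      ≥ I.v Sopt := by
  open OnlineProcurement in
  subst hω
  have hκ : 0 < τ * (1 / 6 * (1 - ε)) + (1 - τ) * (1 / 146) :=
    add_pos_of_nonneg_of_pos (mul_nonneg hτ0 (by linarith)) (by linarith)
  have hf : (0 : ℝ) < n.factorial := by exact_mod_cast n.factorial_pos
  rw [ge_iff_le, le_inv_mul_iff₀ hκ]
  -- When the optimum is worth 0, nonnegativity is enough; otherwise the thresholds used below are
  -- positive.
  rcases (I.v_nonneg Sopt).eq_or_lt with hV | hV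
  · rw [← hV, mul_zero]
    exact expectedValue_nonneg I _
  have hN := noPredMechanism_value I hSopt hV tie hT₁ ⟨0.66, by norm_num, by norm_num⟩ rfl
  have hP : 1 / 6 * (1 - ε) * I.v Sopt ≤ (∑ π : Equiv.Perm (Fin n),
      expectedValue I (predMechanism I ((1 - ε) * I.v Sopt) ⟨0.46, by norm_num, by norm_num⟩
        0.685 1.85 (List.ofFn π))) / n.factorial := by
    rw [le_div_iff₀ hf, mul_comm]
    refine le_trans (le_of_eq ?_) (Finset.card_nsmul_le_sum Finset.univ _ _ fun π _ =>
      predMechanism_value I hSopt.1 hε0 hε1 hV (mem_ofFn_perm π) _ rfl)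
    rw [Finset.card_univ, Fintype.card_perm, Fintype.card_fin, nsmul_eq_mul]
  simp only [expectedValue_randomOrder, combinedMechanism, expectedValue_bind, Fintype.sum_bool,
    coin_true, coin_false, if_true, Bool.false_eq_true, if_false]
  rw [Finset.sum_add_distrib, ← Finset.mul_sum, ← Finset.mul_sum, add_div, mul_div_assoc,
    mul_div_assoc, add_mul, mul_assoc, mul_assoc (1 - τ)]
  exact add_le_add (mul_le_mul_of_nonneg_left hP hτ0)
    (mul_le_mul_of_nonneg_left hN (by linarith))
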